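/- For $n\ge 0$ and $N=2^n$ let $\star_n$ be the Laver operation on $\{1,\dots,N\}$, i.e. the unique binary operation with $p\star_n 1=p+1 \bmod N$ for all $p$ and $p\star_n(q\star_n 1)=(p\star_n q)\star_n(p\star_n 1)$ for all $p$ and all $q<N$. For nonnegative integers $p,q$ put $p*q=N-(N-p)\star_n(N-q)$, where $N=2^n$ is any power of two with $p,q<N$ (the value does not depend on $n$). For $p\ge 1$ let $\pi(p)$ be the least positive period of the sequence $p*0,\,p*1,\,p*2,\dots$. Let $\mathrm{bit}(r)$ be the number of ones in the binary expansion of $r$, and call a positive integer $p$ maximal if $\pi(p)=2^{\mathrm{bit}(p-1)}$. Let $k\ge 1$ and $m\ge 0$ be integers and let $p-1=(2^{2^k+1}-1)\,2^{2^{k-1}+m2^k}$. Then the sequence $(p*q)_{q\ge 0}$ is periodic and its period satisfies $\pi(p)\le 2^{2^k}$. In particular, for every $k\geq 1$, the integer $(2^{2^k+1}-1)\,2^{2^{k-1}}+1$ is not maximal. -/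

import Mathlib

/-- The two defining rules of the Laver operation of size `N`. The elements `1, 2, …, N` are written
as residue classes modulo `N`, the element `N` being the class `0`:
`p ⋆ 1 = p + 1 mod N` and `p ⋆ (q ⋆ 1) = (p ⋆ q) ⋆ (p ⋆ 1)` for `q < N`. -/
def IsLaverOp (N : ℕ) (op : ZMod N → ZMod N → ZMod N) : Prop :=
  (∀ p, op p 1 = p + 1) ∧
    ∀ p q, q ≠ 0 → op p (op q 1) = op (op p q) (op p 1)

/-- Auxiliary, for the existence proof only: the Laver operation on `{1, …, N}`, computed by
descending recursion on `p` and ascending recursion on `q`. -/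
def laverAux (N p q : ℕ) : ℕ :=
  if p < N then
    if q ≤ 1 then p + 1
    else if p < laverAux N p (q - 1) then laverAux N (laverAux N p (q - 1)) (p + 1) else N
  else q
termination_by (N - p, q)
decreasing_by all_goals omega

theorem laverAux_bounds (N p q : ℕ) (hp : p < N) : p < laverAux N p q ∧ laverAux N p q ≤ N := by
  induction h : N - p using Nat.strong_induction_on generalizing p q with
  | _ d ih =>
    rw [laverAux.eq_def, if_pos hp]
    split_ifs with h0 h1
    · omega
    · rcases lt_or_ge (laverAux N p (q - 1)) N with h2 | h2
      · have := ih (N - laverAux N p (q - 1)) (by omega) _ (p + 1) h2 rfl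
        omega
      · rw [laverAux.eq_def, if_neg (by omega)]
        omega
    · exact ⟨hp, le_rfl⟩

theorem laverAux_one (N p : ℕ) (hp : p < N) : laverAux N p 1 = p + 1 := by
  rw [laverAux.eq_def, if_pos hp, if_pos le_rfl]

theorem laverAux_top (N p q : ℕ) (hp : N ≤ p) : laverAux N p q = q := by
  rw [laverAux.eq_def, if_neg (by omega)]

theorem laverAux_succ (N p q : ℕ) (hp : p < N) (hq : q ≠ 0) :
    laverAux N p (q + 1) = laverAux N (laverAux N p q) (p + 1) := by
  rw [laverAux.eq_def, if_pos hp, if_neg (by omega), Nat.add_sub_cancel,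
    if_pos (laverAux_bounds N p q hp).1]

/-- The representative of a residue class modulo `N` in `{1, …, N}`. -/
def laverRep (N : ℕ) (x : ZMod N) : ℕ := if x.val = 0 then N else x.val

theorem laverRep_cast (N r : ℕ) (h1 : 1 ≤ r) (h2 : r ≤ N) : laverRep N (r : ZMod N) = r := by
  unfold laverRep
  rw [ZMod.val_natCast]
  rcases h2.lt_or_eq with h | rfl
  · rw [Nat.mod_eq_of_lt h, if_neg (by omega)]
  · simp

theorem laverRep_spec (N : ℕ) [NeZero N] (x : ZMod N) :
    1 ≤ laverRep N x ∧ laverRep N x ≤ N ∧ ((laverRep N x : ℕ) : ZMod N) = x := by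
  have hN := NeZero.pos N
  have hx := ZMod.val_lt x
  unfold laverRep
  split_ifs with h
  · exact ⟨hN, le_rfl, by rw [ZMod.natCast_self]; exact ((ZMod.val_eq_zero x).1 h).symm⟩
  · exact ⟨by omega, hx.le, ZMod.natCast_zmod_val x⟩

theorem isLaverOp_aux (N : ℕ) [NeZero N] :
    IsLaverOp N fun p q => (laverAux N (laverRep N p) (laverRep N q) : ℕ) := by
  have hN := NeZero.pos N
  have h1 : laverRep N (1 : ZMod N) = 1 := by
    have := laverRep_cast N 1 le_rfl hN
    simpa using this
  have key : ∀ p : ZMod N, ((laverAux N (laverRep N p) 1 : ℕ) : ZMod N) = p + 1 := by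
    intro p
    obtain ⟨hp1, hp2, hp3⟩ := laverRep_spec N p
    rcases hp2.lt_or_eq with h | h
    · rw [laverAux_one N _ h]; push_cast; rw [hp3]
    · rw [laverAux_top N _ _ h.ge]
      have : p = 0 := by rw [← hp3, h, ZMod.natCast_self]
      simp [this]
  refine ⟨fun p => by simpa only [h1] using key p, fun p q hq => ?_⟩
  simp only [h1, key]
  obtain ⟨hp1, hp2, hp3⟩ := laverRep_spec N p
  obtain ⟨hq1, hq2, hq3⟩ := laverRep_spec N q
  have hqN : laverRep N q < N := by
    refine lt_of_le_of_ne hq2 fun h => hq ?_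
    rw [← hq3, h, ZMod.natCast_self]
  have hq' : laverRep N (q + 1) = laverRep N q + 1 := by
    have := laverRep_cast N (laverRep N q + 1) (by omega) (by omega)
    push_cast at this
    rwa [hq3] at this
  rw [hq']
  rcases hp2.lt_or_eq with h | h
  · have hp' : laverRep N (p + 1) = laverRep N p + 1 := by
      have := laverRep_cast N (laverRep N p + 1) (by omega) (by omega)
      push_cast at this
      rwa [hp3] at this
    have hb := laverAux_bounds N (laverRep N p) (laverRep N q) h
    rw [hp', laverRep_cast N _ (by omega) hb.2, laverAux_succ N _ _ h (by omega)]
  · have hp0 : p = 0 := by rw [← hp3, h, ZMod.natCast_self]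
    rw [laverAux_top N _ _ h.ge, laverAux_top N _ _ h.ge, hp0, zero_add, h1,
      laverRep_cast N _ hq1 hq2, laverAux_one N _ hqN]

theorem IsLaverOp.eq_aux {N : ℕ} [NeZero N] {op : ZMod N → ZMod N → ZMod N} (h : IsLaverOp N op)
    (p q : ℕ) (hp : 1 ≤ p) (hpN : p ≤ N) (hq : 1 ≤ q) (hqN : q ≤ N) :
    op p q = (laverAux N p q : ℕ) := by
  have hne : ∀ r : ℕ, 1 ≤ r → r < N → ((r : ℕ) : ZMod N) ≠ 0 := by
    intro r h1 h2 h3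
    rw [ZMod.natCast_eq_zero_iff] at h3
    exact absurd (Nat.le_of_dvd h1 h3) (by omega)
  have hstep : ∀ (x : ZMod N) (r : ℕ), 1 ≤ r → r < N →
      op x ((r + 1 : ℕ) : ZMod N) = op (op x r) (x + 1) := by
    intro x r h1 h2
    have := h.2 x r (hne r h1 h2)
    rw [h.1, h.1] at this
    push_cast
    exact this
  induction hd : N - p using Nat.strong_induction_on generalizing p q with
  | _ d ih =>
    rcases hpN.lt_or_eq with hlt | heq
    · induction q, hq using Nat.le_induction with
      | base => rw [laverAux_one N p hlt]; push_cast; exact h.1 p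
      | succ q hq ihq =>
        have hb := laverAux_bounds N p q hlt
        rw [hstep p q hq (by omega), ihq (by omega), laverAux_succ N p q hlt (by omega)]
        have := ih (N - laverAux N p q) (by omega) (laverAux N p q) (p + 1) (by omega) hb.2
          (by omega) (by omega) rfl
        push_cast at this
        exact this
    · rw [laverAux_top N p q heq.ge, heq, ZMod.natCast_self]
      induction q, hq using Nat.le_induction with
      | base => push_cast; rw [h.1, zero_add]
      | succ q hq ihq =>
        rw [hstep 0 q hq (by omega), ihq (by omega), zero_add, h.1]
        push_cast
        rfl

theorem existsUnique_isLaverOp (N : ℕ) [NeZero N] : ∃! op, IsLaverOp N op := by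
  refine ⟨_, isLaverOp_aux N, fun op h => ?_⟩
  funext p q
  obtain ⟨hp1, hp2, hp3⟩ := laverRep_spec N p
  obtain ⟨hq1, hq2, hq3⟩ := laverRep_spec N q
  have := h.eq_aux _ _ hp1 hp2 hq1 hq2
  rwa [hp3, hq3] at this

/-- The operation `⋆ₙ` of the Laver table of size `2 ^ n`. -/
noncomputable def laverStar (n : ℕ) : ZMod (2 ^ n) → ZMod (2 ^ n) → ZMod (2 ^ n) :=
  (existsUnique_isLaverOp (2 ^ n)).choose

theorem isLaverOp_laverStar (n : ℕ) : IsLaverOp (2 ^ n) (laverStar n) :=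
  (existsUnique_isLaverOp (2 ^ n)).choose_spec.1

/-- The operation `p * q = N - (N - p) ⋆ₙ (N - q)` on nonnegative integers, where `N = 2 ^ n` is a
power of two larger than `p` and `q` (the value does not depend on it; here `n = max p q`).
Since `⋆ₙ` takes values in `{1, …, N}`, the right side is the representative in `{0, …, N - 1}`
of the class of `- ((-p) ⋆ₙ (-q))`. -/
noncomputable def laverMul (p q : ℕ) : ℕ :=
  (-laverStar (max p q) (-(p : ZMod (2 ^ max p q))) (-(q : ZMod (2 ^ max p q)))).val

/-- The period `π(p)`: the least positive period of the sequence `p * 0, p * 1, p * 2, …`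
(and `0` if there were none). -/
noncomputable def laverPeriod (p : ℕ) : ℕ :=
  sInf {t : ℕ | 0 < t ∧ Function.Periodic (laverMul p) t}

/-- The number of ones in the binary expansion of `n`. -/
def bitCount (n : ℕ) : ℕ := (Nat.digits 2 n).count 1

/-- A positive integer `p` is maximal if `π(p) = 2 ^ bit(p - 1)`. -/
def IsLaverMaximal (p : ℕ) : Prop := 0 < p ∧ laverPeriod p = 2 ^ bitCount (p - 1)

namespace Laver

/-! With `c = 2 ^ (k - 1) + m * 2 ^ k`, negation turns `p` into `2 ^ c - 1` in the table of size `2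
^ (c + 2 ^ k + 1)`, so the claim bounds one row period. For fixed `a`, `n ↦ perLog n a` grows by 0
or 1 at each step. Read backwards, `a` acts on indices, sending `h` to the last `n` with `perLog n a
≤ h`. By left distributivity `a ⋆ x` acts as the conjugate of `x` by `a` (`exists_product`).

The core is `jumpsAt_and_translatesAt`, for `2 ^ k ∣ c`. Translations at smaller indices conjugate
into shifts (`exists_isShift`), shifts force every element with critical index below `c` to move `c`
to at least `c + 2 ^ k` (`jumpsAt_of_shifts`), and this makes `2 ^ c - 1` act as `h ↦ c + h` on an
initial range (`translatesAt_of_jumpsAt`).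

In the theorem `c` is only an odd multiple of `D = 2 ^ (k - 1)`. Were the period too large, `2 ^ c -
1` would still translate by `c`. Conjugating `2 ^ D - 1`, which sends `0 ↦ D ↦ 2 * D`, would give an
element sending `c ↦ c + D ↦ c + 2 * D`. But `2 * D ∣ c + D`, so `c + D` must move to at least `c +
3 * D` (`perLog_two_pow_sub_one_le`). -/

instance (n : ℕ) : NeZero (2 ^ n) := ⟨by positivity⟩

/-! ### Rows of a Laver table -/

theorem star_one (n : ℕ) (p : ZMod (2 ^ n)) : laverStar n p 1 = p + 1 :=
  (isLaverOp_laverStar n).1 p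

theorem star_add_one_of_ne {n : ℕ} (p : ZMod (2 ^ n)) {q : ZMod (2 ^ n)} (hq : q ≠ 0) :
    laverStar n p (q + 1) = laverStar n (laverStar n p q) (p + 1) := by
  have := (isLaverOp_laverStar n).2 p q hq
  rwa [star_one, star_one] at this

theorem star_eq_zero_or_lt {n : ℕ} {p : ZMod (2 ^ n)} (hp : p ≠ 0) (q : ZMod (2 ^ n)) :
    laverStar n p q = 0 ∨ p.val < (laverStar n p q).val := by
  obtain ⟨hq1, hq2, hq3⟩ := laverRep_spec (2 ^ n) q
  have hp0 : p.val ≠ 0 := fun h => hp ((ZMod.val_eq_zero p).1 h)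
  have hpN := ZMod.val_lt p
  have h := (isLaverOp_laverStar n).eq_aux p.val (laverRep (2 ^ n) q) (by omega) hpN.le hq1 hq2
  rw [ZMod.natCast_zmod_val, hq3] at h
  have hb := laverAux_bounds (2 ^ n) p.val (laverRep (2 ^ n) q) hpN
  rw [h]
  rcases hb.2.lt_or_eq with h1 | h1
  · right
    rw [ZMod.val_natCast, Nat.mod_eq_of_lt h1]
    exact hb.1
  · left
    rw [h1, ZMod.natCast_self]

/-- Induction along the rows of a Laver table, from the last one upwards. -/
theorem row_induction {n : ℕ} {P : ZMod (2 ^ n) → Prop} (h0 : P 0)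
    (h : ∀ p, p ≠ 0 → (∀ q, P (laverStar n p q)) → P p) (p : ZMod (2 ^ n)) : P p := by
  induction hd : 2 ^ n - p.val using Nat.strong_induction_on generalizing p with
  | _ d ih =>
    by_cases hp : p = 0
    · rwa [hp]
    · refine h p hp fun q => ?_
      rcases star_eq_zero_or_lt hp q with h1 | h1
      · rwa [h1]
      · have := ZMod.val_lt (laverStar n p q)
        exact ih _ (by omega) _ rfl

theorem natCast_ne_zero {n z : ℕ} (h1 : 0 < z) (h2 : z < 2 ^ n) : ((z : ℕ) : ZMod (2 ^ n)) ≠ 0 := by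
  rw [Ne, ZMod.natCast_eq_zero_iff]
  exact fun h => absurd (Nat.le_of_dvd h1 h) (by omega)

theorem exists_natCast_eq {n : ℕ} (q : ZMod (2 ^ n)) :
    ∃ z : ℕ, 1 ≤ z ∧ z ≤ 2 ^ n ∧ (z : ZMod (2 ^ n)) = q :=
  ⟨_, laverRep_spec (2 ^ n) q⟩

theorem zero_star {n : ℕ} (q : ZMod (2 ^ n)) : laverStar n 0 q = q := by
  obtain ⟨z, h1, h2, rfl⟩ := exists_natCast_eq q
  induction z, h1 using Nat.le_induction with
  | base => simp [star_one]
  | succ z hz ih =>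
    push_cast
    rw [star_add_one_of_ne 0 (natCast_ne_zero hz h2), ih (by omega), zero_add, star_one]

/-! ### Row periods and projection between tables -/

/-- The row of `p` in the table of size `2 ^ n` has period `2 ^ k`, in terms of its zeros. -/
def HasPeriodLog (n : ℕ) (p : ZMod (2 ^ n)) (k : ℕ) : Prop :=
  ∀ z : ℕ, laverStar n p z = 0 ↔ 2 ^ k ∣ z

theorem HasPeriodLog.star_zero {n k : ℕ} {p : ZMod (2 ^ n)} (h : HasPeriodLog n p k) :
    laverStar n p 0 = 0 := by
  simpa using (h 0).2 (dvd_zero _)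

theorem star_add_one_of_star_zero {n : ℕ} {p : ZMod (2 ^ n)} (h : laverStar n p 0 = 0)
    (q : ZMod (2 ^ n)) : laverStar n p (q + 1) = laverStar n (laverStar n p q) (p + 1) := by
  by_cases hq : q = 0
  · rw [hq, h, zero_star, zero_add, star_one]
  · exact star_add_one_of_ne p hq

theorem star_add_of_star_eq_zero {n : ℕ} {p : ZMod (2 ^ n)} (h : laverStar n p 0 = 0)
    {q : ZMod (2 ^ n)} (hq : laverStar n p q = 0) (z : ℕ) :
    laverStar n p (q + z) = laverStar n p z := by
  induction z with
  | zero => simp [h, hq]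
  | succ z ih =>
    push_cast
    rw [← add_assoc, star_add_one_of_star_zero h, star_add_one_of_star_zero h, ih]

theorem hasPeriodLog_zero (n : ℕ) : HasPeriodLog n 0 n := by
  intro z
  rw [zero_star, ZMod.natCast_eq_zero_iff]

/-- The projection of the table of size `2 ^ (n + 1)` onto that of size `2 ^ n`. -/
def proj (n : ℕ) : ZMod (2 ^ (n + 1)) →+* ZMod (2 ^ n) :=
  ZMod.castHom (pow_dvd_pow 2 n.le_succ) _

/-- A nonzero `q` may project to `0`, so the recursion downstairs is needed at `0` as well; `hn`
provides it, and is itself obtained by induction on the table size. -/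
theorem proj_star_of {n : ℕ} (hn : ∀ p : ZMod (2 ^ n), laverStar n p 0 = 0)
    (p q : ZMod (2 ^ (n + 1))) :
    proj n (laverStar (n + 1) p q) = laverStar n (proj n p) (proj n q) := by
  revert q
  induction p using row_induction with
  | h0 => intro q; simp [zero_star]
  | h p hp ih =>
    intro q
    obtain ⟨z, h1, h2, rfl⟩ := exists_natCast_eq q
    induction z, h1 using Nat.le_induction with
    | base => simp [star_one]
    | succ z hz ihz =>
      push_cast
      rw [star_add_one_of_ne p (natCast_ne_zero hz h2), ih, ihz (by omega), map_add, map_add,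
        map_one, star_add_one_of_star_zero (hn (proj n p))]

theorem proj_eq_zero_iff {n : ℕ} (p : ZMod (2 ^ (n + 1))) :
    proj n p = 0 ↔ p = 0 ∨ p.val = 2 ^ n := by
  have hlt := ZMod.val_lt p
  have h1 : proj n p = ((p.val : ℕ) : ZMod (2 ^ n)) := by
    rw [← map_natCast (proj n), ZMod.natCast_zmod_val]
  rw [h1, ZMod.natCast_eq_zero_iff, ← ZMod.val_eq_zero]
  have hN : 2 ^ (n + 1) = 2 ^ n * 2 := pow_succ 2 n
  constructor
  · rintro ⟨t, ht⟩
    have : t < 2 := by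
      by_contra hc
      have := Nat.mul_le_mul_left (2 ^ n) (not_lt.1 hc)
      omega
    interval_cases t <;> simp_all
  · rintro (h | h) <;> simp [h]

/-- The entry lying over the zero at `2 ^ k` is `0` or `2 ^ n`. If `0`, the period is unchanged. If
`2 ^ n`, it exceeds `p`, and the entries after it exceed `2 ^ n` until they vanish, so the next zero
downstairs, at `2 ^ (k + 1)`, lifts to a zero and the period doubles. -/
theorem exists_hasPeriodLog_succ {n : ℕ}
    (hn : ∀ p : ZMod (2 ^ n), laverStar n p 0 = 0) (p : ZMod (2 ^ (n + 1))) {k : ℕ}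
    (hk : HasPeriodLog n (proj n p) k) (hkn : k ≤ n) :
    HasPeriodLog (n + 1) p k ∨ HasPeriodLog (n + 1) p (k + 1) ∧ p.val < 2 ^ n := by
  by_cases hp : p = 0
  · have : k = n := by
      rw [hp, map_zero] at hk
      have := (hk (2 ^ n)).symm.trans ((hasPeriodLog_zero n) (2 ^ n))
      have h2 := (hk (2 ^ k)).symm.trans ((hasPeriodLog_zero n) (2 ^ k))
      have h3 := h2.1 dvd_rfl
      exact le_antisymm hkn ((Nat.pow_dvd_pow_iff_le_right (by norm_num)).1 h3)
    right
    subst hp this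
    exact ⟨hasPeriodLog_zero _, by simp⟩
  have hP0 : 0 < 2 ^ k := by positivity
  have hPn : 2 ^ k ≤ 2 ^ n := Nat.pow_le_pow_right (by norm_num) hkn
  have hN : 2 ^ (n + 1) = 2 * 2 ^ n := by ring
  have hz : ∀ z : ℕ, proj n (laverStar (n + 1) p z) = 0 ↔ 2 ^ k ∣ z := by
    intro z
    rw [proj_star_of hn, map_natCast]
    exact hk z
  -- a zero at a divisor of the size makes the row periodic
  have key : ∀ j : ℕ, j ≤ n + 1 → laverStar (n + 1) p ((2 ^ j : ℕ) : ZMod (2 ^ (n + 1))) = 0 →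
      laverStar (n + 1) p 0 = 0 := by
    intro j hj h0
    have hjpos : 0 < 2 ^ j := by positivity
    have hper : ∀ z : ℕ, 1 ≤ z → z + 2 ^ j ≤ 2 ^ (n + 1) →
        laverStar (n + 1) p ((z + 2 ^ j : ℕ) : ZMod (2 ^ (n + 1))) =
          laverStar (n + 1) p (z : ZMod (2 ^ (n + 1))) := by
      intro z hz1
      induction z, hz1 using Nat.le_induction with
      | base =>
        intro h
        have := star_add_one_of_ne p (natCast_ne_zero hjpos (n := n + 1) (by omega))
        rw [h0, zero_star] at this
        push_cast at this ⊢
        rw [add_comm (1 : ZMod (2 ^ (n + 1))), this, star_one]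
      | succ z hz ih =>
        intro h
        have e1 := star_add_one_of_ne p
          (natCast_ne_zero (z := z + 2 ^ j) (n := n + 1) (by omega) (by omega))
        have e2 := star_add_one_of_ne p (natCast_ne_zero (z := z) (n := n + 1) hz (by omega))
        rw [ih (by omega), ← e2] at e1
        have : z + 1 + 2 ^ j = z + 2 ^ j + 1 := by ring
        rw [this]
        push_cast at e1 ⊢
        exact e1
    have hmul : ∀ t : ℕ, 1 ≤ t → t * 2 ^ j ≤ 2 ^ (n + 1) →
        laverStar (n + 1) p ((t * 2 ^ j : ℕ) : ZMod (2 ^ (n + 1))) = 0 := by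
      intro t ht
      induction t, ht using Nat.le_induction with
      | base => intro _; rwa [one_mul]
      | succ t ht ih =>
        intro h
        rw [add_mul, one_mul] at h ⊢
        rw [hper _ (Nat.mul_pos ht hjpos) h]
        exact ih (by omega)
    have h2 : 2 ^ (n + 1 - j) * 2 ^ j = 2 ^ (n + 1) := by
      rw [← pow_add]; congr 1; omega
    have := hmul (2 ^ (n + 1 - j)) Nat.one_le_two_pow h2.le
    rw [h2, ZMod.natCast_self] at this
    exact this
  rcases (proj_eq_zero_iff _).1 ((hz (2 ^ k)).2 dvd_rfl) with h0 | h0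
  · left
    have hs := key k (by omega) h0
    intro z
    refine ⟨fun h => (hz z).1 (by rw [h, map_zero]), ?_⟩
    rintro ⟨t, rfl⟩
    induction t with
    | zero => simpa using hs
    | succ t ih =>
      have := star_add_of_star_eq_zero hs ih (2 ^ k)
      rw [h0] at this
      rw [mul_add, mul_one]
      push_cast at this ⊢
      exact this
  · right
    have hpv : p.val < 2 ^ n := by
      rcases star_eq_zero_or_lt hp ((2 ^ k : ℕ) : ZMod (2 ^ (n + 1))) with h | h
      · rw [h, ZMod.val_zero] at h0
        have : 0 < 2 ^ n := by positivity
        omega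
      · omega
    refine ⟨?_, hpv⟩
    have hne : laverStar (n + 1) p ((2 ^ k : ℕ) : ZMod (2 ^ (n + 1))) ≠ 0 := by
      intro h
      rw [h, ZMod.val_zero] at h0
      have : 0 < 2 ^ n := by positivity
      omega
    have hhigh : ∀ j : ℕ, 1 ≤ j → j ≤ 2 ^ k →
        laverStar (n + 1) p ((2 ^ k + j : ℕ) : ZMod (2 ^ (n + 1))) = 0 ∨
          2 ^ n < (laverStar (n + 1) p ((2 ^ k + j : ℕ) : ZMod (2 ^ (n + 1)))).val := by
      intro j hj
      induction j, hj using Nat.le_induction with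
      | base =>
        intro _
        have := star_add_one_of_ne p (natCast_ne_zero (z := 2 ^ k) (n := n + 1) hP0 (by omega))
        have e : ((2 ^ k + 1 : ℕ) : ZMod (2 ^ (n + 1))) = ((2 ^ k : ℕ) : ZMod (2 ^ (n + 1))) + 1 := by
          push_cast; rfl
        rw [e, this, ← h0]
        exact star_eq_zero_or_lt hne _
      | succ j hj ih =>
        intro hj2
        have hne2 : laverStar (n + 1) p ((2 ^ k + j : ℕ) : ZMod (2 ^ (n + 1))) ≠ 0 := by
          intro h
          have h3 := (hz (2 ^ k + j)).1 (by rw [h, map_zero])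
          have h4 := (Nat.dvd_add_right (dvd_refl _)).1 h3
          exact absurd (Nat.le_of_dvd hj h4) (by omega)
        have := star_add_one_of_ne p
          (natCast_ne_zero (z := 2 ^ k + j) (n := n + 1) (by omega) (by omega))
        have e : ((2 ^ k + (j + 1) : ℕ) : ZMod (2 ^ (n + 1))) =
            ((2 ^ k + j : ℕ) : ZMod (2 ^ (n + 1))) + 1 := by
          push_cast; ring
        rw [e, this]
        rcases star_eq_zero_or_lt hne2 (p + 1) with h | h
        · exact Or.inl h
        · right
          rcases ih (by omega) with h5 | h5
          · exact absurd h5 hne2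
          · omega
    have h2P : laverStar (n + 1) p ((2 ^ (k + 1) : ℕ) : ZMod (2 ^ (n + 1))) = 0 := by
      have e : 2 ^ (k + 1) = 2 ^ k + 2 ^ k := by ring
      rw [e]
      rcases hhigh (2 ^ k) hP0 le_rfl with h | h
      · exact h
      · rcases (proj_eq_zero_iff _).1 ((hz (2 ^ k + 2 ^ k)).2 ⟨2, by ring⟩) with h6 | h6
        · exact h6
        · omega
    have hs := key (k + 1) (by omega) h2P
    have hmul : ∀ t : ℕ, laverStar (n + 1) p ((2 ^ (k + 1) * t : ℕ) : ZMod (2 ^ (n + 1))) = 0 := by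
      intro t
      induction t with
      | zero => simpa using hs
      | succ t ih =>
        have := star_add_of_star_eq_zero hs ih (2 ^ (k + 1))
        rw [h2P] at this
        rw [mul_add, mul_one]
        push_cast at this ⊢
        exact this
    intro z
    refine ⟨fun h => ?_, ?_⟩
    · obtain ⟨t, rfl⟩ := (hz z).1 (by rw [h, map_zero])
      rcases Nat.even_or_odd' t with ⟨s, rfl | rfl⟩
      · exact ⟨s, by ring⟩
      · exfalso
        have := star_add_of_star_eq_zero hs (hmul s) (2 ^ k)
        apply hne
        rw [← this, ← h]
        push_cast
        congr 1
        ring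
    · rintro ⟨t, rfl⟩
      exact hmul t

theorem HasPeriodLog.le {n k : ℕ} {p : ZMod (2 ^ n)} (h : HasPeriodLog n p k) : k ≤ n := by
  have := (h (2 ^ n)).1 (by rw [ZMod.natCast_self]; exact h.star_zero)
  exact (Nat.pow_dvd_pow_iff_le_right (by norm_num)).1 this

theorem exists_hasPeriodLog (n : ℕ) (p : ZMod (2 ^ n)) : ∃ k, HasPeriodLog n p k := by
  induction n with
  | zero =>
    refine ⟨0, fun z => ?_⟩
    have : Subsingleton (ZMod (2 ^ 0)) := by rw [pow_zero]; infer_instance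
    simp [Subsingleton.elim _ (0 : ZMod (2 ^ 0))]
  | succ n ih =>
    obtain ⟨k, hk⟩ := ih (proj n p)
    have hn : ∀ p : ZMod (2 ^ n), laverStar n p 0 = 0 := fun p => (ih p).choose_spec.star_zero
    rcases exists_hasPeriodLog_succ hn p hk hk.le with h | h
    · exact ⟨_, h⟩
    · exact ⟨_, h.1⟩

theorem star_zero {n : ℕ} (p : ZMod (2 ^ n)) : laverStar n p 0 = 0 :=
  (exists_hasPeriodLog n p).choose_spec.star_zero

theorem star_add_one {n : ℕ} (p q : ZMod (2 ^ n)) :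
    laverStar n p (q + 1) = laverStar n (laverStar n p q) (p + 1) :=
  star_add_one_of_star_zero (star_zero p) q

theorem proj_star {n : ℕ} (p q : ZMod (2 ^ (n + 1))) :
    proj n (laverStar (n + 1) p q) = laverStar n (proj n p) (proj n q) :=
  proj_star_of star_zero p q

/-- Left distributivity of the Laver operation. -/
theorem star_star {n : ℕ} (a b c : ZMod (2 ^ n)) :
    laverStar n a (laverStar n b c) = laverStar n (laverStar n a b) (laverStar n a c) := by
  revert b c
  induction a using row_induction with
  | h0 => intro b c; simp [zero_star]
  | h a _ iha =>
    intro b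
    induction b using row_induction with
    | h0 => intro c; simp [zero_star, star_zero]
    | h b _ ihb =>
      intro c
      obtain ⟨z, -, -, rfl⟩ := exists_natCast_eq c
      induction z with
      | zero => simp [star_zero]
      | succ z ih =>
        push_cast
        rw [star_add_one b, ihb, ih, star_add_one a b, ← iha, star_add_one a]

/-! ### The period as a function of the table size -/

/-- The binary logarithm of the period of the row of `a` in the table of size `2 ^ n`. -/
noncomputable def perLog (n a : ℕ) : ℕ := (exists_hasPeriodLog n (a : ZMod (2 ^ n))).choose

theorem star_natCast_eq_zero_iff {n a z : ℕ} :
    laverStar n (a : ZMod (2 ^ n)) (z : ZMod (2 ^ n)) = 0 ↔ 2 ^ perLog n a ∣ z :=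
  (exists_hasPeriodLog n (a : ZMod (2 ^ n))).choose_spec z

theorem HasPeriodLog.unique {n k l : ℕ} {p : ZMod (2 ^ n)} (hk : HasPeriodLog n p k)
    (hl : HasPeriodLog n p l) : k = l := by
  have h1 := (hk (2 ^ l)).1 ((hl _).2 dvd_rfl)
  have h2 := (hl (2 ^ k)).1 ((hk _).2 dvd_rfl)
  rw [Nat.pow_dvd_pow_iff_le_right (by norm_num)] at h1 h2
  omega

theorem perLog_le (n a : ℕ) : perLog n a ≤ n :=
  (exists_hasPeriodLog n (a : ZMod (2 ^ n))).choose_spec.le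

theorem perLog_succ (n a : ℕ) : perLog (n + 1) a = perLog n a ∨
    perLog (n + 1) a = perLog n a + 1 ∧ a % 2 ^ (n + 1) < 2 ^ n := by
  have hk : HasPeriodLog n (proj n (a : ZMod (2 ^ (n + 1)))) (perLog n a) := by
    rw [map_natCast]
    exact (exists_hasPeriodLog n (a : ZMod (2 ^ n))).choose_spec
  have h := exists_hasPeriodLog_succ star_zero _ hk (perLog_le n a)
  have hs := (exists_hasPeriodLog (n + 1) (a : ZMod (2 ^ (n + 1)))).choose_spec
  rw [ZMod.val_natCast] at h
  rcases h with h | h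
  · exact Or.inl (hs.unique h)
  · exact Or.inr ⟨hs.unique h.1, h.2⟩

theorem perLog_zero (a : ℕ) : perLog 0 a = 0 := Nat.le_zero.1 (perLog_le 0 a)

theorem perLog_mono (a : ℕ) : Monotone fun n => perLog n a :=
  monotone_nat_of_le_succ fun n => by rcases perLog_succ n a with h | h <;> omega

theorem perLog_add_le (n m a : ℕ) : perLog (n + m) a ≤ perLog n a + m := by
  induction m with
  | zero => simp
  | succ m ih => rcases perLog_succ (n + m) a with h | h <;> rw [← add_assoc] <;> omega

/-- Equality forces growth at every step up to `n`, and the residue condition in `perLog_succ` then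
makes each binary digit of `a` below `n` vanish. -/
theorem perLog_eq_self_iff {n a : ℕ} : perLog n a = n ↔ 2 ^ n ∣ a := by
  refine ⟨fun h => ?_, fun h => ?_⟩
  · induction n with
    | zero => simp
    | succ n ih =>
      have h1 := perLog_le n a
      rcases perLog_succ n a with h2 | h2
      · omega
      obtain ⟨t, rfl⟩ := ih (by omega)
      have h3 := h2.2
      rw [pow_succ, Nat.mul_mod_mul_left] at h3
      have h4 : t % 2 = 0 := by
        by_contra hc
        have : t % 2 = 1 := by omega
        rw [this] at h3
        omega
      rw [pow_succ]
      exact Nat.mul_dvd_mul_left _ (Nat.dvd_of_mod_eq_zero h4)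
  · have h1 : (a : ZMod (2 ^ n)) = 0 := (ZMod.natCast_eq_zero_iff _ _).2 h
    have := (exists_hasPeriodLog n (a : ZMod (2 ^ n))).choose_spec
    rw [h1] at this
    have h2 := this.unique (hasPeriodLog_zero n)
    unfold perLog
    convert h2 using 2
    rw [h1]

theorem val_star_cast {n N : ℕ} (h : n ≤ N) (a x : ℕ) :
    (((laverStar N (a : ZMod (2 ^ N)) (x : ZMod (2 ^ N))).val : ℕ) : ZMod (2 ^ n)) =
      laverStar n (a : ZMod (2 ^ n)) (x : ZMod (2 ^ n)) := by
  induction N, h using Nat.le_induction with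
  | base => rw [ZMod.natCast_zmod_val]
  | succ N h ih =>
    rw [← ih]
    have h1 := proj_star (n := N) (a : ZMod (2 ^ (N + 1))) (x : ZMod (2 ^ (N + 1)))
    rw [map_natCast, map_natCast] at h1
    rw [← h1]
    set y := laverStar (N + 1) (a : ZMod (2 ^ (N + 1))) (x : ZMod (2 ^ (N + 1)))
    have h2 : proj N y = ((y.val : ℕ) : ZMod (2 ^ N)) := by
      rw [← map_natCast (proj N), ZMod.natCast_zmod_val]
    rw [h2, ZMod.val_natCast, ZMod.natCast_eq_natCast_iff]
    exact ((Nat.mod_modEq _ _).of_dvd (pow_dvd_pow 2 h)).symm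

theorem star_eq_zero_iff {n a : ℕ} (y : ZMod (2 ^ n)) :
    laverStar n (a : ZMod (2 ^ n)) y = 0 ↔ 2 ^ perLog n a ∣ y.val := by
  rw [← star_natCast_eq_zero_iff, ZMod.natCast_zmod_val]

theorem two_pow_dvd_val_star_iff {m n : ℕ} (h : m ≤ n) (x z : ℕ) :
    2 ^ m ∣ (laverStar n (x : ZMod (2 ^ n)) (z : ZMod (2 ^ n))).val ↔ 2 ^ perLog m x ∣ z := by
  rw [← ZMod.natCast_eq_zero_iff, val_star_cast h, star_natCast_eq_zero_iff]

/-- Periods of a product, in all tables up to a given size: the identity `a (x z) = (a x) (a z)`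
and the divisibility of `a x`. -/
theorem exists_product (N a x : ℕ) : ∃ b : ℕ, ∀ n ≤ N,
    perLog (perLog n a) x = perLog (perLog n b) a ∧
      (perLog n b = n ↔ perLog (perLog n a) x = perLog n a) := by
  refine ⟨(laverStar N (a : ZMod (2 ^ N)) (x : ZMod (2 ^ N))).val, fun n hn => ?_⟩
  set b := (laverStar N (a : ZMod (2 ^ N)) (x : ZMod (2 ^ N))).val
  have hb : ((b : ℕ) : ZMod (2 ^ n)) = laverStar n a x := val_star_cast hn a x
  constructor
  · have key : ∀ z : ℕ, 2 ^ perLog (perLog n a) x ∣ z ↔ 2 ^ perLog (perLog n b) a ∣ z := by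
      intro z
      rw [← two_pow_dvd_val_star_iff (perLog_le n a), ← two_pow_dvd_val_star_iff (perLog_le n b),
        ← star_eq_zero_iff, ← star_eq_zero_iff, hb, star_star]
    have h1 := (key _).1 dvd_rfl
    have h2 := (key _).2 dvd_rfl
    rw [Nat.pow_dvd_pow_iff_le_right (by norm_num)] at h1 h2
    omega
  · rw [perLog_eq_self_iff, perLog_eq_self_iff, ← ZMod.natCast_eq_zero_iff, hb,
      star_natCast_eq_zero_iff]

theorem perLog_lt_self_of_lt {a u v : ℕ} (h : perLog u a < u) (huv : u ≤ v) : perLog v a < v := by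
  obtain ⟨w, rfl⟩ := Nat.exists_eq_add_of_le huv
  have := perLog_add_le u w a
  omega

/-! ### Shifts, jumps and translations -/

/-- An element `x` whose embedding has critical index `e` and maps `e ↦ e + L ↦ e + 2 * L`. -/
structure IsShift (e L x : ℕ) : Prop where
  crit : perLog e x = e
  left : perLog (e + L) x = e
  left_succ : perLog (e + L + 1) x = e + 1
  right : perLog (e + 2 * L) x = e + L
  right_succ : perLog (e + 2 * L + 1) x = e + L + 1

theorem exists_doubling_scale {c k v : ℕ} (h1 : v < c) (h2 : c < v + 2 ^ k) :
    ∃ l < k, v + 2 ^ l ≤ c ∧ c < v + 2 * 2 ^ l := by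
  induction k with
  | zero => omega
  | succ k ih =>
    by_cases h : c < v + 2 ^ k
    · obtain ⟨l, hl, h3⟩ := ih h
      exact ⟨l, by omega, h3⟩
    · refine ⟨k, by omega, by omega, ?_⟩
      rwa [pow_succ, mul_comm] at h2

/-- If the critical index of `a` is below `c`, then `a` maps `c` to at least `c + E`. -/
def JumpsAt (c E : ℕ) : Prop := ∀ a, perLog c a < c → perLog (c + E) a ≤ c

/-- The map `h ↦ c + h` is realized up to `E` by the element `2 ^ c - 1`. -/
def TranslatesAt (c E : ℕ) : Prop := ∀ h ≤ E + 1, perLog (c + h) (2 ^ c - 1) = h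

/-- Take a counterexample with least `n`. Multiplying it by a suitable shift gives another one for
the same `n`. Minimality pins its value at `c` to `c - L` for a power `L` of two; further shifts
double `L` up to `2 ^ k`, where slope at most one is contradicted. -/
theorem jumpsAt_of_shifts {c k : ℕ} (hkc : 2 ^ k ≤ c)
    (hX : ∀ l < k, ∃ x, IsShift (c - 2 * 2 ^ l) (2 ^ l) x) : JumpsAt c (2 ^ k) := by
  classical
  by_contra hcon
  unfold JumpsAt at hcon
  push Not at hcon
  obtain ⟨a₀, ha₀, ha₀'⟩ := hcon
  have hE : 1 ≤ 2 ^ k := Nat.one_le_two_pow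
  have hex : ∃ n, ∃ a, perLog c a < c ∧ c < perLog (n + 1) a :=
    ⟨c + 2 ^ k - 1, a₀, ha₀, by rwa [Nat.sub_add_cancel (by omega)]⟩
  obtain ⟨n, ⟨a, hac, han⟩, hmin⟩ : ∃ n, (∃ a, perLog c a < c ∧ c < perLog (n + 1) a) ∧
      ∀ m < n, ¬ ∃ a, perLog c a < c ∧ c < perLog (m + 1) a :=
    ⟨Nat.find hex, Nat.find_spec hex, fun m hm => Nat.find_min hex hm⟩
  have hn : n + 1 ≤ c + 2 ^ k := by
    by_contra h
    exact hmin (c + 2 ^ k - 1) (by omega) ⟨a₀, ha₀, by rwa [Nat.sub_add_cancel (by omega)]⟩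
  have hscale : ∀ a, perLog c a < c → c < perLog (n + 1) a →
      ∃ l < k, perLog c a + 2 ^ l ≤ c ∧ c < perLog c a + 2 * 2 ^ l := by
    intro a h1 h2
    refine exists_doubling_scale h1 ?_
    have h3 := perLog_mono a hn
    have h4 := perLog_add_le c (2 ^ k) a
    simp only at h3
    omega
  -- one application of a shift
  have hstep : ∀ a, perLog c a < c → c < perLog (n + 1) a → ∀ l < k,
      perLog c a + 2 ^ l ≤ c → c < perLog c a + 2 * 2 ^ l → ∀ x, 2 * 2 ^ l ≤ c →
      IsShift (c - 2 * 2 ^ l) (2 ^ l) x →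
      ∃ b, (∀ m ≤ n + 1, perLog (perLog m a) x = perLog (perLog m b) a ∧
        (perLog m b = m ↔ perLog (perLog m a) x = perLog m a)) ∧
        perLog c b < c ∧ c < perLog (n + 1) b ∧ c < perLog (c + 1) a + 2 ^ l := by
    intro a h1 h2 l hl h3 h4 x h5 hx
    obtain ⟨b, hb⟩ := exists_product (n + 1) a x
    have hcn : c < n + 1 := h2.trans_le (perLog_le _ _)
    have e1 : c - 2 * 2 ^ l + 2 ^ l = c - 2 ^ l := by omega
    have e2 : c - 2 * 2 ^ l + 2 * 2 ^ l = c := by omega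
    have hxr := hx.right_succ
    have hxl := hx.left
    rw [e2, e1] at hxr
    rw [e1] at hxl
    have hlp : 0 < 2 ^ l := by positivity
    have hbc : perLog c b < c := by
      refine lt_of_le_of_ne (perLog_le _ _) fun h => ?_
      have h6 := ((hb c hcn.le).2).1 h
      have h7 : perLog (c - 2 * 2 ^ l + 1) x < c - 2 * 2 ^ l + 1 := by
        have := perLog_mono x (show c - 2 * 2 ^ l + 1 ≤ c - 2 ^ l by omega)
        simp only at this
        omega
      have := perLog_lt_self_of_lt h7 (v := perLog c a) (by omega)
      omega
    have hbn := (hb (n + 1) le_rfl).1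
    have h8 := perLog_mono x (show c + 1 ≤ perLog (n + 1) a by omega)
    simp only at h8
    refine ⟨b, hb, hbc, ?_, ?_⟩
    · by_contra h
      have := perLog_mono a (not_lt.1 h)
      simp only at this
      omega
    -- Otherwise `perLog (n + 1) b` exceeds `c + 1`, so `perLog n b` exceeds `c` and `b` is a
    -- counterexample at `n - 1`.
    · by_contra h
      have h9 : c + 1 < perLog (n + 1) b := by
        by_contra h9
        have := perLog_mono a (not_lt.1 h9)
        simp only at this
        omega
      have h10 := perLog_succ n b
      have hn0 : n - 1 + 1 = n := by
        have := perLog_le (n + 1) b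
        omega
      exact hmin (n - 1) (by omega) ⟨b, hbc, by rw [hn0]; omega⟩
  have hpowk : ∀ l < k, 2 * 2 ^ l ≤ 2 ^ k := fun l hl => by
    rw [← pow_succ']
    exact Nat.pow_le_pow_right (by norm_num) hl
  -- an element fixing everything below `c - L` and mapping `c - L` to `c`
  obtain ⟨l₀, hl₀, b₀, hb₁, hb₂, hb₃⟩ : ∃ l < k, ∃ b, perLog (c - 2 ^ l) b = c - 2 ^ l ∧
      perLog c b = c - 2 ^ l ∧ c < perLog (n + 1) b := by
    obtain ⟨l, hl, h3, h4⟩ := hscale a hac han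
    obtain ⟨x, hx⟩ := hX l hl
    have h5 : 2 * 2 ^ l ≤ c := (hpowk l hl).trans hkc
    obtain ⟨b, hb, hbc, hbn, ha1⟩ := hstep a hac han l hl h3 h4 x h5 hx
    obtain ⟨l', hl', h3', h4'⟩ := hscale b hbc hbn
    obtain ⟨x', hx'⟩ := hX l' hl'
    obtain ⟨-, -, -, -, hb1⟩ :=
      hstep b hbc hbn l' hl' h3' h4' x' ((hpowk l' hl').trans hkc) hx'
    have hcn : c < n + 1 := han.trans_le (perLog_le _ _)
    have hlp : 0 < 2 ^ l := by positivity
    have e1 : c - 2 * 2 ^ l + 2 ^ l = c - 2 ^ l := by omega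
    have hxl := hx.left
    have hxl' := hx.left_succ
    rw [e1] at hxl hxl'
    have hxe := hx.crit
    -- `h3'` is one inequality; `hb1` with slope at most one is the other.
    have heq : perLog c b = c - 2 ^ l' := by
      have := perLog_succ c b
      omega
    -- `perLog c b` is the critical index of `b`
    have h6 : perLog (perLog c b) a = c - 2 * 2 ^ l := by
      rw [← (hb c hcn.le).1]
      have h7 := perLog_mono x (show perLog c a ≤ c - 2 ^ l by omega)
      have h8 := perLog_mono x (show c - 2 * 2 ^ l ≤ perLog c a by omega)
      simp only at h7 h8
      omega
    refine ⟨l', hl', b, ?_, heq, hbn⟩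
    rw [← heq]
    refine ((hb _ ((perLog_le _ _).trans hcn.le)).2).2 ?_
    rw [h6, hxe]
  -- doubling `L` repeatedly
  have hdouble : ∀ j, l₀ + j ≤ k → ∃ b, perLog (c - 2 ^ (l₀ + j)) b = c - 2 ^ (l₀ + j) ∧
      perLog c b = c - 2 ^ (l₀ + j) ∧ c < perLog (n + 1) b := by
    intro j
    induction j with
    | zero => exact fun _ => ⟨b₀, hb₁, hb₂, hb₃⟩
    | succ j ih =>
      intro hj
      obtain ⟨b, h1, h2, h3⟩ := ih (by omega)
      obtain ⟨x, hx⟩ := hX (l₀ + j) (by omega)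
      have h5 : 2 * 2 ^ (l₀ + j) ≤ c := (hpowk _ (by omega)).trans hkc
      have hcn : c < n + 1 := h3.trans_le (perLog_le _ _)
      have hlp : 0 < 2 ^ (l₀ + j) := by positivity
      have e0 : 2 ^ (l₀ + (j + 1)) = 2 * 2 ^ (l₀ + j) := by ring
      rw [e0]
      set L := 2 ^ (l₀ + j)
      obtain ⟨b', hb', hbc', hbn', -⟩ := hstep b (by omega) h3 (l₀ + j) (by omega)
        (by omega) (by omega) x h5 hx
      have e1 : c - 2 * L + L = c - L := by omega
      have hxl := hx.left
      rw [e1] at hxl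
      have hxe := hx.crit
      have hbe : perLog (c - 2 * L) b = c - 2 * L := by
        by_contra hne
        have := perLog_lt_self_of_lt (lt_of_le_of_ne (perLog_le _ _) hne)
          (show c - 2 * L ≤ c - L by omega)
        omega
      have hfix : perLog (c - 2 * L) b' = c - 2 * L := by
        refine ((hb' _ (by omega)).2).2 ?_
        rw [hbe, hxe]
      refine ⟨b', hfix, ?_, hbn'⟩
      have h6 : perLog (perLog c b') b = c - 2 * L := by
        rw [← (hb' c hcn.le).1, h2, hxl]
      have h7 : perLog c b' < c - L := by
        by_contra h7
        have := perLog_mono b (not_lt.1 h7)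
        simp only at this
        omega
      have h8 : perLog (perLog c b') b = perLog c b' := by
        by_contra hne
        have := perLog_lt_self_of_lt (lt_of_le_of_ne (perLog_le _ _) hne) h7.le
        omega
      omega
  -- From `c - 2 ^ k` at index `c`, at most `2 ^ k` further steps cannot pass `c`.
  obtain ⟨b, -, h2, h3⟩ := hdouble (k - l₀) (by omega)
  rw [show l₀ + (k - l₀) = k by omega] at h2
  obtain ⟨m, hm⟩ : ∃ m, n + 1 = c + m := Nat.exists_eq_add_of_le
    (show c ≤ n + 1 from h3.le.trans (perLog_le _ _))
  have := perLog_add_le c m b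
  rw [← hm] at this
  omega

/-- A stall at `c` gains one index over `hK`: a shift carries a violation for `d` to a product whose
value at `c + 2 ^ k + 1` exceeds `c + 1`, hence exceeds `c` one index earlier, against `hK`. -/
theorem perLog_le_of_skip {c k : ℕ} (hkc : 2 ^ k ≤ c)
    (hX : ∀ l < k, ∃ x, IsShift (c - 2 * 2 ^ l) (2 ^ l) x) (hK : JumpsAt c (2 ^ k)) {d : ℕ}
    (hd : perLog c d < c) (hd' : perLog (c + 1) d = perLog c d) :
    perLog (c + 2 ^ k + 1) d ≤ c := by
  by_contra hcon
  have hlt : c < perLog c d + 2 ^ k := by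
    have := perLog_add_le (c + 1) (2 ^ k) d
    rw [show c + 1 + 2 ^ k = c + 2 ^ k + 1 by ring] at this
    omega
  obtain ⟨l, hl, h3, h4⟩ := exists_doubling_scale hd hlt
  obtain ⟨x, hx⟩ := hX l hl
  have h5 : 2 * 2 ^ l ≤ c := by
    refine le_trans ?_ hkc
    rw [← pow_succ']
    exact Nat.pow_le_pow_right (by norm_num) hl
  obtain ⟨b, hb⟩ := exists_product (c + 2 ^ k + 1) d x
  have e1 : c - 2 * 2 ^ l + 2 ^ l = c - 2 ^ l := by omega
  have e2 : c - 2 * 2 ^ l + 2 * 2 ^ l = c := by omega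
  have hxr := hx.right_succ
  have hxl := hx.left
  rw [e2, e1] at hxr
  rw [e1] at hxl
  have hlp : 0 < 2 ^ l := by positivity
  have hbc : perLog c b < c := by
    refine lt_of_le_of_ne (perLog_le _ _) fun h => ?_
    have h6 := ((hb c (by omega)).2).1 h
    have h7 : perLog (c - 2 * 2 ^ l + 1) x < c - 2 * 2 ^ l + 1 := by
      have := perLog_mono x (show c - 2 * 2 ^ l + 1 ≤ c - 2 ^ l by omega)
      simp only at this
      omega
    have := perLog_lt_self_of_lt h7 (v := perLog c d) (by omega)
    omega
  have h8 := perLog_mono x (show c + 1 ≤ perLog (c + 2 ^ k + 1) d by omega)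
  simp only at h8
  have hbn := (hb (c + 2 ^ k + 1) le_rfl).1
  have h9 : c + 1 < perLog (c + 2 ^ k + 1) b := by
    by_contra h9
    have := perLog_mono d (not_lt.1 h9)
    simp only at this
    omega
  have := hK b hbc
  have := perLog_succ (c + 2 ^ k) b
  omega

theorem perLog_two_pow_sub_one (c : ℕ) : perLog c (2 ^ c - 1) = 0 := by
  have h : laverStar c ((2 ^ c - 1 : ℕ) : ZMod (2 ^ c)) ((1 : ℕ) : ZMod (2 ^ c)) = 0 := by
    rw [Nat.cast_one, star_one, ← Nat.cast_add_one,
      Nat.sub_add_cancel Nat.one_le_two_pow, ZMod.natCast_self]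
  rw [star_natCast_eq_zero_iff, Nat.dvd_one] at h
  by_contra hne
  exact absurd h (Nat.one_lt_two_pow hne).ne'

theorem translatesAt_of_lt {c E : ℕ} (h : E < perLog (c + E + 1) (2 ^ c - 1)) :
    TranslatesAt c E := by
  intro j hj
  have h1 := perLog_add_le c j (2 ^ c - 1)
  rw [perLog_two_pow_sub_one] at h1
  have h2 := perLog_add_le (c + j) (E + 1 - j) (2 ^ c - 1)
  rw [show c + j + (E + 1 - j) = c + E + 1 by omega] at h2
  omega

/-- For `0 < q < 2 ^ c` the period of `2 ^ c * i + q` divides `2 ^ c * i`: by `hK` if `i` is even,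
and by `perLog_le_of_skip` if `i` is odd, as the digit one in place `c` prevents doubling there. So
the row of `2 ^ c * i` begins by counting upwards, and `2 ^ c - 1` acts on `i ≥ 1` as multiplication
by `2 ^ c`. -/
theorem translatesAt_of_jumpsAt {c k : ℕ} (hkc : 2 ^ k ≤ c)
    (hX : ∀ l < k, ∃ x, IsShift (c - 2 * 2 ^ l) (2 ^ l) x) (hK : JumpsAt c (2 ^ k)) :
    TranslatesAt c (2 ^ k) := by
  apply translatesAt_of_lt
  set M := c + 2 ^ k + 1 with hM
  have hdvd : ∀ i q, 0 < q → q < 2 ^ c → 2 ^ perLog M (2 ^ c * i + q) ∣ 2 ^ c * i := by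
    intro i q hq hqc
    set d := 2 ^ c * i + q with hd
    have hdc : perLog c d < c := by
      refine lt_of_le_of_ne (perLog_le _ _) fun h => ?_
      have h1 := perLog_eq_self_iff.1 h
      have h2 := (Nat.dvd_add_right (dvd_mul_right _ _)).1 h1
      exact absurd (Nat.le_of_dvd hq h2) (by omega)
    rcases Nat.even_or_odd' i with ⟨s, hs | hs⟩
    · have h1 : perLog M d ≤ c + 1 := by
        rw [hM]
        have := hK d hdc
        have := perLog_succ (c + 2 ^ k) d
        omega
      refine (pow_dvd_pow 2 h1).trans ⟨s, ?_⟩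
      rw [hs]; ring
    · have h1 : perLog (c + 1) d = perLog c d := by
        rcases perLog_succ c d with h | h
        · exact h
        · exfalso
          have h2 : d % 2 ^ (c + 1) = 2 ^ c + q := by
            have : d = 2 ^ c + q + 2 ^ (c + 1) * s := by rw [hd, hs]; ring
            rw [this, Nat.add_mul_mod_self_left, Nat.mod_eq_of_lt]
            rw [pow_succ]; omega
          omega
      exact (pow_dvd_pow 2 (perLog_le_of_skip hkc hX hK hdc h1)).trans (dvd_mul_right _ _)
  have hrow : ∀ i z : ℕ, 1 ≤ z → z ≤ 2 ^ c →
      laverStar M ((2 ^ c * i : ℕ) : ZMod (2 ^ M)) (z : ZMod (2 ^ M)) =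
        ((2 ^ c * i + z : ℕ) : ZMod (2 ^ M)) := by
    intro i z hz
    induction z, hz using Nat.le_induction with
    | base => intro _; rw [Nat.cast_one, star_one]; push_cast; rfl
    | succ z hz ih =>
      intro hzc
      have h1 := star_natCast_eq_zero_iff.2 (hdvd i z hz (by omega))
      have h2 := star_add_of_star_eq_zero (star_zero _) h1 1
      rw [Nat.cast_one, star_one] at h2
      rw [Nat.cast_add z, Nat.cast_one, star_add_one, ih (by omega), h2]
      push_cast
      ring
  have hmul : ∀ i : ℕ, 1 ≤ i →
      laverStar M ((2 ^ c - 1 : ℕ) : ZMod (2 ^ M)) (i : ZMod (2 ^ M)) =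
        ((2 ^ c * i : ℕ) : ZMod (2 ^ M)) := by
    have h1 : ((2 ^ c - 1 : ℕ) : ZMod (2 ^ M)) + 1 = ((2 ^ c : ℕ) : ZMod (2 ^ M)) := by
      rw [← Nat.cast_add_one, Nat.sub_add_cancel Nat.one_le_two_pow]
    intro i hi
    induction i, hi using Nat.le_induction with
    | base => rw [Nat.cast_one, star_one, h1, mul_one]
    | succ i hi ih =>
      rw [Nat.cast_add i, Nat.cast_one, star_add_one, ih, h1,
        hrow i (2 ^ c) Nat.one_le_two_pow le_rfl, mul_add, mul_one]
  by_contra hcon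
  have h1 := star_natCast_eq_zero_iff.2 (pow_dvd_pow 2 (not_lt.1 hcon))
  rw [hmul _ Nat.one_le_two_pow, ← pow_add] at h1
  exact natCast_ne_zero (by positivity) (Nat.pow_lt_pow_right (by norm_num) (by omega)) h1

/-- The shift is the conjugate of `2 ^ L - 1`, sending `0 ↦ L ↦ 2 * L`, by the translation `2 ^ e -
1`. -/
theorem exists_isShift {e L : ℕ} (hL : 1 ≤ L) (h1 : TranslatesAt e (2 * L))
    (h2 : TranslatesAt L L) : ∃ x, IsShift e L x := by
  obtain ⟨b, hb⟩ := exists_product (e + 2 * L + 1) (2 ^ e - 1) (2 ^ L - 1)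
  have hx0 := perLog_two_pow_sub_one L
  have ha0 := perLog_two_pow_sub_one e
  -- The range in `TranslatesAt` reaches `E + 1` so that `h = 2 * L` still has a neighbour above it.
  have hval : ∀ h u, 1 ≤ h → h ≤ 2 * L → perLog u (2 ^ e - 1) = h → u = e + h := by
    intro h u hh1 hh2 hu
    by_contra hne
    rcases lt_or_gt_of_ne hne with h3 | h3
    · have := perLog_mono (2 ^ e - 1) (show u ≤ e + (h - 1) by omega)
      simp only at this
      rw [h1 (h - 1) (by omega)] at this
      omega
    · have := perLog_mono (2 ^ e - 1) (show e + (h + 1) ≤ u by omega)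
      simp only at this
      rw [h1 (h + 1) (by omega)] at this
      omega
  have hcrit : perLog e b = e := by
    refine ((hb e (by omega)).2).2 ?_
    rw [ha0, perLog_zero]
  refine ⟨b, hcrit, ?_, ?_, ?_, ?_⟩
  · have h3 := (hb (e + L) (by omega)).1
    rw [h1 L (by omega), hx0] at h3
    have h4 : perLog (e + L) b ≤ e := by
      by_contra h
      have := perLog_mono (2 ^ e - 1) (show e + 1 ≤ perLog (e + L) b by omega)
      simp only at this
      rw [h1 1 (by omega)] at this
      omega
    have h5 := perLog_mono b (show e ≤ e + L by omega)
    simp only at h5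
    omega
  · have h3 := (hb (e + (L + 1)) (by omega)).1
    rw [h1 (L + 1) (by omega), h2 1 (by omega)] at h3
    exact hval 1 _ le_rfl (by omega) h3.symm
  · have h3 := (hb (e + 2 * L) (by omega)).1
    rw [h1 (2 * L) (by omega), two_mul, h2 L (by omega)] at h3
    rw [two_mul]
    exact hval L _ hL (by omega) h3.symm
  · have h3 := (hb (e + (2 * L + 1)) (by omega)).1
    rw [h1 (2 * L + 1) (by omega), show 2 * L + 1 = L + (L + 1) by ring, h2 (L + 1) le_rfl] at h3
    rw [show e + 2 * L + 1 = e + (L + (L + 1)) by ring]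
    exact hval (L + 1) _ (by omega) (by omega) h3.symm

/-- Induction on `c` for all `k` together: the shift of length `2 ^ l` with `l < k` needs
translations only at `c - 2 ^ (l + 1)` and at `2 ^ l`, both below `c` and suitably divisible. -/
theorem jumpsAt_and_translatesAt (c k : ℕ) (h : 2 ^ k ∣ c) :
    JumpsAt c (2 ^ k) ∧ TranslatesAt c (2 ^ k) := by
  induction c using Nat.strong_induction_on generalizing k with
  | _ c ih =>
    rcases Nat.eq_zero_or_pos c with rfl | hc
    · refine ⟨fun a ha => absurd ha (Nat.not_lt_zero _), fun j _ => ?_⟩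
      rw [zero_add]
      exact perLog_eq_self_iff.2 (by simp)
    have hkc := Nat.le_of_dvd hc h
    have hX : ∀ l < k, ∃ x, IsShift (c - 2 * 2 ^ l) (2 ^ l) x := by
      intro l hl
      have hlp : 0 < 2 ^ l := by positivity
      have h1 : 2 ^ (l + 1) ∣ c := (pow_dvd_pow 2 hl).trans h
      have h2 : 2 * 2 ^ l = 2 ^ (l + 1) := (pow_succ' 2 l).symm
      have h3 := Nat.le_of_dvd hc h1
      refine exists_isShift hlp ?_ (ih _ (by omega) l dvd_rfl).2
      rw [h2]
      exact (ih _ (by omega) (l + 1) (Nat.dvd_sub h1 dvd_rfl)).2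
    have hK := jumpsAt_of_shifts hkc hX
    exact ⟨hK, translatesAt_of_jumpsAt hkc hX hK⟩

/-! ### The obstruction at odd multiples -/

/-- The element `2 ^ c - 1` does not realize the translation by `c` beyond `2 * D` when `c` is an
odd multiple of `D = 2 ^ l`. -/
theorem perLog_two_pow_sub_one_le (l m : ℕ) :
    perLog (2 ^ l + m * 2 ^ (l + 1) + 2 ^ (l + 1) + 1) (2 ^ (2 ^ l + m * 2 ^ (l + 1)) - 1) ≤
      2 ^ (l + 1) := by
  by_contra hcon
  set D := 2 ^ l with hD
  have e2 : 2 ^ (l + 1) = 2 * D := pow_succ' 2 l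
  have hDpos : 0 < D := by positivity
  rw [e2] at hcon
  set c := D + m * (2 * D) with hc
  have ha : TranslatesAt c (2 * D) := translatesAt_of_lt (by omega)
  have hx : TranslatesAt D D := (jumpsAt_and_translatesAt D l dvd_rfl).2
  have hK : JumpsAt (c + D) (2 * D) := by
    rw [← e2]
    refine (jumpsAt_and_translatesAt (c + D) (l + 1) ⟨m + 1, ?_⟩).1
    rw [e2, hc]; ring
  -- Under the assumed translation, `b` sends `c + D` only to `c + 2 * D`, which `hK` forbids.
  obtain ⟨b, hb⟩ := exists_product (c + (2 * D + 1)) (2 ^ c - 1) (2 ^ D - 1)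
  have hbc : perLog (c + D) b < c + D := by
    refine lt_of_le_of_ne (perLog_le _ _) fun h => ?_
    have h1 := ((hb (c + D) (by omega)).2).1 h
    rw [ha D (by omega), perLog_two_pow_sub_one] at h1
    omega
  have h1 := hK b hbc
  have h2 := (hb (c + (2 * D + 1)) le_rfl).1
  rw [ha _ le_rfl, show 2 * D + 1 = D + (D + 1) by ring, hx _ le_rfl] at h2
  have h3 : perLog (c + (D + (D + 1))) b ≤ c + D := by
    refine le_trans ?_ h1
    exact perLog_mono b (show c + (D + (D + 1)) ≤ c + D + 2 * D by omega)
  have h4 := perLog_mono (2 ^ c - 1) h3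
  simp only at h4
  rw [ha D (by omega)] at h4
  omega

/-! ### Return to `laverMul` and its period -/

theorem val_eq_of_proj {n : ℕ} (y : ZMod (2 ^ (n + 1))) (h : y.val < 2 ^ n) :
    y.val = (proj n y).val := by
  have h2 : proj n y = ((y.val : ℕ) : ZMod (2 ^ n)) := by
    rw [← map_natCast (proj n), ZMod.natCast_zmod_val]
  rw [h2, ZMod.val_natCast, Nat.mod_eq_of_lt h]

/-- Nonzero entries in the row of `-p` exceed `2 ^ (n + 1) - p ≥ 2 ^ n`, so their negatives lie
below `2 ^ n` and are determined by the projection. -/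
theorem val_neg_star_succ {n p : ℕ} (hp : 1 ≤ p) (hpn : p ≤ 2 ^ n) (q : ℕ) :
    (-laverStar (n + 1) (-(p : ZMod (2 ^ (n + 1)))) (-(q : ZMod (2 ^ (n + 1))))).val =
      (-laverStar n (-(p : ZMod (2 ^ n))) (-(q : ZMod (2 ^ n)))).val := by
  have hN : 2 ^ (n + 1) = 2 ^ n * 2 := pow_succ 2 n
  have hpos : 0 < 2 ^ n := by positivity
  have hp0 : (p : ZMod (2 ^ (n + 1))) ≠ 0 := natCast_ne_zero hp (by omega)
  have hpv : (-(p : ZMod (2 ^ (n + 1)))).val = 2 ^ (n + 1) - p := by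
    have : NeZero (p : ZMod (2 ^ (n + 1))) := ⟨hp0⟩
    rw [ZMod.val_neg_of_ne_zero, ZMod.val_natCast, Nat.mod_eq_of_lt (by omega)]
  have hlt : (-laverStar (n + 1) (-(p : ZMod (2 ^ (n + 1)))) (-(q : ZMod (2 ^ (n + 1))))).val <
      2 ^ n := by
    rcases star_eq_zero_or_lt (neg_ne_zero.2 hp0) (-(q : ZMod (2 ^ (n + 1)))) with h | h
    · rw [h, neg_zero, ZMod.val_zero]
      exact hpos
    · rw [ZMod.neg_val]
      split_ifs with h0
      · exact hpos
      · omega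
  rw [val_eq_of_proj _ hlt, map_neg, proj_star, map_neg, map_neg, map_natCast, map_natCast]

theorem val_neg_star_of_le {n N p : ℕ} (hp : 1 ≤ p) (hpn : p ≤ 2 ^ n) (h : n ≤ N) (q : ℕ) :
    (-laverStar N (-(p : ZMod (2 ^ N))) (-(q : ZMod (2 ^ N)))).val =
      (-laverStar n (-(p : ZMod (2 ^ n))) (-(q : ZMod (2 ^ n)))).val := by
  induction N, h using Nat.le_induction with
  | base => rfl
  | succ N h ih =>
    rw [val_neg_star_succ hp (hpn.trans (Nat.pow_le_pow_right (by norm_num) h)), ih]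

/-- The value of `p * q` computed in any table containing `p`. -/
theorem laverMul_eq {n p : ℕ} (hp : 1 ≤ p) (hpn : p ≤ 2 ^ n) (q : ℕ) :
    laverMul p q = (-laverStar n (-(p : ZMod (2 ^ n))) (-(q : ZMod (2 ^ n)))).val := by
  have h1 : p ≤ 2 ^ max p q :=
    Nat.lt_two_pow_self.le.trans (Nat.pow_le_pow_right (by norm_num) (le_max_left p q))
  unfold laverMul
  rw [← val_neg_star_of_le hp h1 (le_max_left _ n), ← val_neg_star_of_le hp hpn (le_max_right _ n)]

theorem periodic_laverMul {n p a : ℕ} (hp : 1 ≤ p) (hpn : p + a = 2 ^ n) :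
    Function.Periodic (laverMul p) (2 ^ perLog n a) := by
  have ha : -(p : ZMod (2 ^ n)) = a := by
    rw [neg_eq_iff_add_eq_zero, ← Nat.cast_add, hpn, ZMod.natCast_self]
  intro q
  rw [laverMul_eq hp (by omega : p ≤ 2 ^ n), laverMul_eq hp (by omega : p ≤ 2 ^ n), ha]
  obtain ⟨z, -, -, hz⟩ := exists_natCast_eq (-((q + 2 ^ perLog n a : ℕ) : ZMod (2 ^ n)))
  have h0 := star_natCast_eq_zero_iff.2 (dvd_refl (2 ^ perLog n a))
  have := star_add_of_star_eq_zero (star_zero (a : ZMod (2 ^ n))) h0 z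
  rw [hz] at this
  rw [← this]
  push_cast
  congr 3
  ring

theorem laverPeriod_le {n p a : ℕ} (hp : 1 ≤ p) (hpn : p + a = 2 ^ n) :
    0 < laverPeriod p ∧ laverPeriod p ≤ 2 ^ perLog n a := by
  have hmem : 2 ^ perLog n a ∈ {t : ℕ | 0 < t ∧ Function.Periodic (laverMul p) t} :=
    ⟨by positivity, periodic_laverMul hp hpn⟩
  exact ⟨(Nat.sInf_mem ⟨_, hmem⟩).1, Nat.sInf_le hmem⟩

/-! ### Counting binary ones -/

theorem bitCount_two_mul_add {x b : ℕ} (hb : b < 2) :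
    bitCount (b + 2 * x) = b + bitCount x := by
  unfold bitCount
  by_cases h : b = 0 ∧ x = 0
  · obtain ⟨rfl, rfl⟩ := h
    simp
  · rw [Nat.digits_add 2 (by norm_num) b x hb (by omega)]
    interval_cases b <;> simp [add_comm]

theorem bitCount_mul_two_pow (x c : ℕ) : bitCount (x * 2 ^ c) = bitCount x := by
  induction c with
  | zero => simp
  | succ c ih =>
    have := bitCount_two_mul_add (x := x * 2 ^ c) (b := 0) (by norm_num)
    rw [zero_add, zero_add, ih] at this
    rw [← this]
    congr 1
    ring

theorem bitCount_two_pow_sub_one (b : ℕ) : bitCount (2 ^ b - 1) = b := by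
  induction b with
  | zero => simp [bitCount]
  | succ b ih =>
    have := bitCount_two_mul_add (x := 2 ^ b - 1) (b := 1) (by norm_num)
    have h1 : 1 ≤ 2 ^ b := Nat.one_le_two_pow
    have h2 : 2 ^ (b + 1) - 1 = 1 + 2 * (2 ^ b - 1) := by rw [pow_succ]; omega
    rw [h2, this, ih, add_comm]

end Laver

theorem mainTheorem11 (k : ℕ) (hk : 1 ≤ k) :
    (∀ m p : ℕ, p = (2 ^ (2 ^ k + 1) - 1) * 2 ^ (2 ^ (k - 1) + m * 2 ^ k) + 1 →
      0 < laverPeriod p ∧ laverPeriod p ≤ 2 ^ 2 ^ k) ∧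
    ¬ IsLaverMaximal ((2 ^ (2 ^ k + 1) - 1) * 2 ^ 2 ^ (k - 1) + 1) := by
  obtain ⟨l, rfl⟩ : ∃ l, k = l + 1 := ⟨k - 1, by omega⟩
  rw [Nat.add_sub_cancel]
  have key : ∀ m p : ℕ, p = (2 ^ (2 ^ (l + 1) + 1) - 1) * 2 ^ (2 ^ l + m * 2 ^ (l + 1)) + 1 →
      0 < laverPeriod p ∧ laverPeriod p ≤ 2 ^ 2 ^ (l + 1) := by
    rintro m p rfl
    have hpos : 1 ≤ 2 ^ (2 ^ l + m * 2 ^ (l + 1)) := Nat.one_le_two_pow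
    -- Adding `2 ^ c` to `p - 1` completes its block of ones to a power of two, which identifies
    -- `-p` with `2 ^ c - 1`.
    have hmul : (2 ^ (2 ^ (l + 1) + 1) - 1) * 2 ^ (2 ^ l + m * 2 ^ (l + 1)) +
        2 ^ (2 ^ l + m * 2 ^ (l + 1)) = 2 ^ (2 ^ l + m * 2 ^ (l + 1) + 2 ^ (l + 1) + 1) := by
      rw [← Nat.succ_mul, Nat.succ_eq_add_one, Nat.sub_add_cancel Nat.one_le_two_pow, ← pow_add]
      congr 1
      ring
    have h := Laver.laverPeriod_le (n := 2 ^ l + m * 2 ^ (l + 1) + 2 ^ (l + 1) + 1)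
      (p := (2 ^ (2 ^ (l + 1) + 1) - 1) * 2 ^ (2 ^ l + m * 2 ^ (l + 1)) + 1)
      (a := 2 ^ (2 ^ l + m * 2 ^ (l + 1)) - 1) (by omega) (by omega)
    exact ⟨h.1, h.2.trans
      (Nat.pow_le_pow_right (by norm_num) (Laver.perLog_two_pow_sub_one_le l m))⟩
  refine ⟨key, fun hmax => ?_⟩
  have h1 := (key 0 _ rfl).2
  rw [zero_mul, add_zero, hmax.2, Nat.add_sub_cancel, Laver.bitCount_mul_two_pow,
    Laver.bitCount_two_pow_sub_one] at h1
  exact absurd h1 (not_le.2 (Nat.pow_lt_pow_right (by norm_num) (Nat.lt_succ_self _)))
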